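/- Let $k$ be a field of characteristic $0$. A (left) Leibniz algebra over $k$ is a $k$-vector space $\mathfrak g$ with a bilinear bracket such that $[[x,y],z]=[x,[y,z]]-[y,[x,z]]$ for all $x,y,z\in\mathfrak g$. Let $T(\mathfrak g)$ be the tensor algebra on $\mathfrak g$, graded with $\mathfrak g$ in degree $1$, with the differential of degree $-1$ of the standard complex for Leibniz homology with trivial coefficients, $$d(x_1x_2\cdots x_n)=\sum_{1\le i<j\le n}(-1)^j\, x_1\cdots x_{i-1}\,[x_j,x_i]\,x_{i+1}\cdots\widehat{x_j}\cdots x_n .$$ Let $F(\mathfrak g)=\bigoplus_{n\ge 1}F(\mathfrak g)_n\subset T(\mathfrak g)$ be the free graded Lie algebra on $\mathfrak g$, that is, the smallest graded subspace of $T(\mathfrak g)$ which contains $\mathfrak g$ and is closed under the graded commutator $[\![x,y]\!]=xy-(-1)^{|x||y|}yx$. Then, for every Leibniz algebra $\mathfrak g$ over $k$, one has $d^2=0$ on $T(\mathfrak g)$, and $F(\mathfrak g)$ is a subcomplex: $d(F(\mathfrak g)_{n+1})\subseteq F(\mathfrak g)_n$ for all $n\ge 0$, where $F(\mathfrak g)_0=0$.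 If, moreover, $\mathfrak g$ is the free Leibniz algebra on some set, then $$H_n(F(\mathfrak g),d)=0\qquad\text{for all } n>1 .$$ -/

import Mathlib

universe u v w

/-- A (left) Leibniz algebra over `k`: a vector space with a bilinear bracket satisfying
the left Leibniz identity `[[x, y], z] = [x, [y, z]] - [y, [x, z]]`. -/
class LeibnizAlgebra (k : Type u) (g : Type v) [Field k] [AddCommGroup g] [Module k g] where
  /-- the bracket -/
  bracket : g →ₗ[k] g →ₗ[k] g
  leibniz : ∀ x y z : g,
    bracket (bracket x y) z = bracket x (bracket y z) - bracket y (bracket x z)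

namespace LeibnizAlgebra

section Free

variable (k : Type u) {g : Type v} [Field k] [AddCommGroup g] [Module k g] [LeibnizAlgebra k g]

/-- `g` is the free Leibniz algebra on the family `b : X → g`: every map from `X` to a Leibniz
algebra `h` extends along `b` to a unique homomorphism of Leibniz algebras `g → h`.
(The universe of `h` is large enough to contain copies of `g` and of the Leibniz algebra
of nonassociative words in `X` modulo the Leibniz identity.) -/
def IsFreeOn {X : Type w} (b : X → g) : Prop :=
  ∀ (h : Type (max u v w)) [AddCommGroup h] [Module k h] [LeibnizAlgebra k h] (f : X → h),
    ∃! φ : g →ₗ[k] h,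
      (∀ x y : g, φ (bracket (k := k) x y) = bracket (k := k) (φ x) (φ y)) ∧ ∀ x : X, φ (b x) = f x

end Free

noncomputable section Complex

variable (k : Type u) (g : Type v) [Field k] [AddCommGroup g] [Module k g] [LeibnizAlgebra k g]

/-- The multilinear map sending `(x₀, …, xₙ)` to
`x₀ ⋯ [xⱼ, xᵢ] ⋯ x̂ⱼ ⋯ xₙ`, where the factor `xⱼ` is omitted and the factor `xᵢ` is replaced by
`[xⱼ, xᵢ]`. The index of the factor to be replaced is given as `i : Fin n`, its position after the
omission of `xⱼ`; its original position is `j.succAbove i`. -/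
def differentialTerm {n : ℕ} (j : Fin (n + 1)) (i : Fin n) :
    MultilinearMap k (fun _ : Fin (n + 1) => g) (TensorAlgebra k g) where
  toFun x := TensorAlgebra.tprod k g n
    (Function.update (j.removeNth x) i (bracket (k := k) (x j) (x (j.succAbove i))))
  map_update_add' := by
    intro inst x l a b
    obtain rfl : inst = instDecidableEqFin (n + 1) := Subsingleton.elim _ _
    rcases Fin.eq_self_or_eq_succAbove j l with rfl | ⟨m, rfl⟩
    · simp [Fin.succAbove_ne]
    · by_cases hm : m = i
      · subst hm
        simp [Fin.removeNth_update_succAbove, (Fin.succAbove_ne j m).symm]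
      · have h1 : j.succAbove i ≠ j.succAbove m := fun h =>
          hm (Fin.succAbove_right_injective h).symm
        simp [Fin.removeNth_update_succAbove, (Fin.succAbove_ne j m).symm, h1,
          Function.update_comm hm, Function.update_of_ne]
  map_update_smul' := by
    intro inst x l c a
    obtain rfl : inst = instDecidableEqFin (n + 1) := Subsingleton.elim _ _
    rcases Fin.eq_self_or_eq_succAbove j l with rfl | ⟨m, rfl⟩
    · simp [Fin.succAbove_ne]
    · by_cases hm : m = i
      · subst hm
        simp [Fin.removeNth_update_succAbove, (Fin.succAbove_ne j m).symm]
      · have h1 : j.succAbove i ≠ j.succAbove m := fun h =>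
          hm (Fin.succAbove_right_injective h).symm
        simp [Fin.removeNth_update_succAbove, (Fin.succAbove_ne j m).symm, h1,
          Function.update_comm hm, Function.update_of_ne]

/-- The Leibniz differential on words of length `n`:
`x₁ ⋯ xₙ ↦ ∑_{1 ≤ i < j ≤ n} (-1)ʲ x₁ ⋯ [xⱼ, xᵢ] ⋯ x̂ⱼ ⋯ xₙ`.
In the code the factors are numbered from `0`, so that the sign is `(-1) ^ (j + 1)`. -/
def differentialMultilinear : (n : ℕ) →
    MultilinearMap k (fun _ : Fin n => g) (TensorAlgebra k g)
  | 0 => 0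
  | n + 1 => ∑ j : Fin (n + 1), ∑ i : Fin n,
      if i.castSucc < j then (-1 : k) ^ (j.val + 1) • differentialTerm k g j i else 0

/-- The differential of the standard complex `T(g)` that computes the Leibniz homology of `g` with
trivial coefficients; the degree `n` part of `T(g)` consists of the tensors of length `n`. -/
def differential : TensorAlgebra k g →ₗ[k] TensorAlgebra k g :=
  (DirectSum.toModule k ℕ (TensorAlgebra k g)
    fun n => PiTensorProduct.lift (differentialMultilinear k g n)) ∘ₗ
      (TensorAlgebra.toDirectSum (R := k) (M := g)).toLinearMap

theorem differential_tprod {n : ℕ} (x : Fin n → g) :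
    differential k g (TensorAlgebra.tprod k g n x) = differentialMultilinear k g n x := by
  rw [differential, LinearMap.comp_apply, AlgHom.toLinearMap_apply,
    TensorAlgebra.toDirectSum_tensorPower_tprod]
  exact (DirectSum.toModule_lof k n _).trans (PiTensorProduct.lift.tprod x)

end Complex

section FreeLie

variable (k : Type u) (g : Type v) [Field k] [AddCommGroup g] [Module k g]

/-- `IsLieElement k g n x`: `x` is a degree `n` element of the graded Lie subalgebra of the tensor
algebra `T(g)` (with `g` in degree one) generated by `g` under the graded commutator
`⟦x, y⟧ = x y - (-1)^{|x||y|} y x`. -/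
inductive IsLieElement : ℕ → TensorAlgebra k g → Prop
  | of (x : g) : IsLieElement 1 (TensorAlgebra.ι k x)
  | zero (n : ℕ) : IsLieElement n 0
  | add {n : ℕ} {x y : TensorAlgebra k g} :
      IsLieElement n x → IsLieElement n y → IsLieElement n (x + y)
  | smul {n : ℕ} (c : k) {x : TensorAlgebra k g} : IsLieElement n x → IsLieElement n (c • x)
  | commutator {p q : ℕ} {x y : TensorAlgebra k g} : IsLieElement p x → IsLieElement q y →
      IsLieElement (p + q) (x * y - (-1 : k) ^ (p * q) • (y * x))

/-- The degree `n` part `F(g)ₙ` of the free graded Lie algebra on `g`, realised inside `T(g)`. -/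
def freeLie (n : ℕ) : Submodule k (TensorAlgebra k g) where
  carrier := {x | IsLieElement k g n x}
  add_mem' := IsLieElement.add
  zero_mem' := IsLieElement.zero n
  smul_mem' c _ := IsLieElement.smul c

end FreeLie

section Homology

variable (k : Type u) (g : Type v) [Field k] [AddCommGroup g] [Module k g] [LeibnizAlgebra k g]

/-- The cycles of degree `n` of `F(g)`. -/
def freeLieCycles (n : ℕ) : Submodule k (TensorAlgebra k g) :=
  freeLie k g n ⊓ LinearMap.ker (differential k g)

/-- The boundaries of degree `n` of `F(g)`. -/
def freeLieBoundaries (n : ℕ) : Submodule k (TensorAlgebra k g) :=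
  (freeLie k g (n + 1)).map (differential k g)

/-- The homology `Hₙ(F(g))`: cycles modulo boundaries. -/
abbrev freeLieHomology (n : ℕ) : Type (max u v) :=
  freeLieCycles k g n ⧸ (freeLieBoundaries k g n).submoduleOf (freeLieCycles k g n)

end Homology

end LeibnizAlgebra

/-! The differential obeys `d (u x) = d u x - ad_x (parity u)` for `x` in `g`, where `ad_x` is the
derivation of `T(g)` extending `[x, ·]`. With `d 1 = 0` this determines `d`, and `d² = 0` follows by
induction on length.

Although `d` is not a graded derivation, `d (u z) = d u z ± u d z` holds when `z` is a Lie element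
of degree at least two. By the graded Jacobi identity, `F(g)` is spanned by left-normed commutators,
and on these `d ⟦z, y⟧ = ⟦d z, y⟧ ± ad_y z`. So `d` preserves `F(g)`.

For free `g` there are maps `N`, `σ`, `s` on `g`: `N` is the derivation counting generators, `σ` a
crossed derivation, and `s` takes values in `F(g)₂` with `d s = N - σ`. Extend `s` to a skew
derivation `h` of `T(g)` and `N` to a derivation `W`. In degrees at least two the correction terms
`ad_y z` in `d` cancel the terms in `σ`, leaving `h d + d h = W` on `F(g)`. Every Lie element is a
sum of eigenvectors of `W` in `T(g)` with positive integral eigenvalues, so in characteristic zero a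
cycle can be recovered from its images under powers of `W`, which are boundaries. -/

namespace TensorAlgebra

variable {k : Type u} {g : Type v} [Field k] [AddCommGroup g] [Module k g]

/-- A subspace of the tensor algebra that contains `1` and is stable under right multiplication
by generators is everything. -/
theorem eq_top_of_mul_ι_mem {S : Submodule k (TensorAlgebra k g)} (one : 1 ∈ S)
    (mul : ∀ u ∈ S, ∀ x : g, u * ι k x ∈ S) : S = ⊤ := by
  have key : ∀ a : TensorAlgebra k g, ∀ u ∈ S, u * a ∈ S := by
    intro a
    induction a using TensorAlgebra.induction with
    | algebraMap r =>
      intro u hu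
      rw [← Algebra.commutes, ← Algebra.smul_def]
      exact S.smul_mem r hu
    | ι x => exact fun u hu => mul u hu x
    | mul a b ha hb =>
      intro u hu
      rw [← mul_assoc]
      exact hb _ (ha u hu)
    | add a b ha hb =>
      intro u hu
      rw [mul_add]
      exact S.add_mem (ha u hu) (hb u hu)
  refine eq_top_iff.2 fun a _ => ?_
  simpa using key a 1 one

/-- Two linear maps on the tensor algebra agree if their equaliser contains `1` and is stable under
right multiplication by generators. -/
theorem linearMap_ext_mul_ι {M : Type*} [AddCommGroup M] [Module k M]
    {φ ψ : TensorAlgebra k g →ₗ[k] M} (one : φ 1 = ψ 1)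
    (mul : ∀ u, φ u = ψ u → ∀ x : g, φ (u * ι k x) = ψ (u * ι k x)) (u : TensorAlgebra k g) :
    φ u = ψ u := by
  have : LinearMap.eqLocus φ ψ = ⊤ := eq_top_of_mul_ι_mem one mul
  exact (this ▸ Submodule.mem_top : u ∈ LinearMap.eqLocus φ ψ)

theorem tprod_snoc {n : ℕ} (x : Fin n → g) (y : g) :
    tprod k g (n + 1) (Fin.snoc x y : Fin (n + 1) → g) = tprod k g n x * ι k y := by
  simp only [tprod_apply, List.ofFn_succ', Fin.snoc_castSucc, Fin.snoc_last, List.concat_eq_append,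
    List.prod_append, List.prod_cons, List.prod_nil, mul_one]

theorem span_range_tprod :
    Submodule.span k {u : TensorAlgebra k g | ∃ (n : ℕ) (x : Fin n → g), u = tprod k g n x} = ⊤ := by
  refine eq_top_of_mul_ι_mem ?_ ?_
  · exact Submodule.subset_span ⟨0, Fin.elim0, by simp [tprod_apply]⟩
  · intro u hu y
    induction hu using Submodule.span_induction with
    | mem u hu =>
      obtain ⟨n, x, rfl⟩ := hu
      exact Submodule.subset_span ⟨n + 1, _, (tprod_snoc x y).symm⟩
    | zero => simp
    | add a b _ _ ha hb => rw [add_mul]; exact Submodule.add_mem _ ha hb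
    | smul c a _ ha => rw [smul_mul_assoc]; exact Submodule.smul_mem _ c ha

/-! ### Derivations and twisted derivations of the tensor algebra -/

noncomputable section

/-- The algebra homomorphism `a ↦ !![γ a, δ a; 0, a]` that encodes the `γ`-derivation `δ`
with the values `f` on generators. -/
def twistedDerivationAux (γ : TensorAlgebra k g →ₐ[k] TensorAlgebra k g)
    (f : g →ₗ[k] TensorAlgebra k g) :
    TensorAlgebra k g →ₐ[k] Matrix (Fin 2) (Fin 2) (TensorAlgebra k g) :=
  lift k
    { toFun := fun x => !![γ (ι k x), f x; 0, ι k x]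
      map_add' := fun x y => by
        ext i j
        fin_cases i <;> fin_cases j <;> simp
      map_smul' := fun c x => by
        ext i j
        fin_cases i <;> fin_cases j <;> simp }

theorem twistedDerivationAux_ι (γ : TensorAlgebra k g →ₐ[k] TensorAlgebra k g)
    (f : g →ₗ[k] TensorAlgebra k g) (x : g) :
    twistedDerivationAux γ f (ι k x) = !![γ (ι k x), f x; 0, ι k x] := by
  simp [twistedDerivationAux]

/-- Since the matrices are upper triangular with diagonal `(γ a, a)`, multiplicativity read in the
corner entry is the twisted Leibniz rule. -/
theorem twistedDerivationAux_apply (γ : TensorAlgebra k g →ₐ[k] TensorAlgebra k g)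
    (f : g →ₗ[k] TensorAlgebra k g) (a : TensorAlgebra k g) :
    twistedDerivationAux γ f a 0 0 = γ a ∧ twistedDerivationAux γ f a 1 0 = 0 ∧
      twistedDerivationAux γ f a 1 1 = a := by
  induction a using TensorAlgebra.induction with
  | algebraMap r => simp [Matrix.algebraMap_matrix_apply]
  | ι x => simp [twistedDerivationAux_ι]
  | mul a b ha hb => simp [Matrix.mul_apply, ha, hb]
  | add a b ha hb => simp [ha, hb]

/-- The linear map `δ` with `δ (a * b) = δ a * b + γ a * δ b` and given values on generators. -/
def twistedDerivation (γ : TensorAlgebra k g →ₐ[k] TensorAlgebra k g)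
    (f : g →ₗ[k] TensorAlgebra k g) : TensorAlgebra k g →ₗ[k] TensorAlgebra k g where
  toFun a := twistedDerivationAux γ f a 0 1
  map_add' a b := by simp
  map_smul' c a := by simp

@[simp]
theorem twistedDerivation_ι (γ : TensorAlgebra k g →ₐ[k] TensorAlgebra k g)
    (f : g →ₗ[k] TensorAlgebra k g) (x : g) : twistedDerivation γ f (ι k x) = f x := by
  simp [twistedDerivation, twistedDerivationAux_ι]

theorem twistedDerivation_mul (γ : TensorAlgebra k g →ₐ[k] TensorAlgebra k g)
    (f : g →ₗ[k] TensorAlgebra k g) (a b : TensorAlgebra k g) :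
    twistedDerivation γ f (a * b) =
      twistedDerivation γ f a * b + γ a * twistedDerivation γ f b := by
  simp [twistedDerivation, Matrix.mul_apply, twistedDerivationAux_apply, add_comm]

@[simp]
theorem twistedDerivation_one (γ : TensorAlgebra k g →ₐ[k] TensorAlgebra k g)
    (f : g →ₗ[k] TensorAlgebra k g) : twistedDerivation γ f 1 = 0 := by
  simp [twistedDerivation]

/-- The derivation of the tensor algebra with given values on generators. -/
def derivation (f : g →ₗ[k] TensorAlgebra k g) : TensorAlgebra k g →ₗ[k] TensorAlgebra k g :=
  twistedDerivation (AlgHom.id k _) f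

@[simp]
theorem derivation_ι (f : g →ₗ[k] TensorAlgebra k g) (x : g) : derivation f (ι k x) = f x :=
  twistedDerivation_ι _ f x

theorem derivation_mul (f : g →ₗ[k] TensorAlgebra k g) (a b : TensorAlgebra k g) :
    derivation f (a * b) = derivation f a * b + a * derivation f b :=
  twistedDerivation_mul _ f a b

@[simp]
theorem derivation_one (f : g →ₗ[k] TensorAlgebra k g) : derivation f 1 = 0 :=
  twistedDerivation_one _ f

variable (k g) in
/-- The automorphism of the tensor algebra that multiplies the part of degree `n` by `(-1)ⁿ`. -/
def parity : TensorAlgebra k g →ₐ[k] TensorAlgebra k g := lift k (-ι k)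

@[simp]
theorem parity_ι (x : g) : parity k g (ι k x) = -ι k x := by
  simp [parity]

theorem parity_tprod {n : ℕ} (x : Fin n → g) :
    parity k g (tprod k g n x) = (-1 : k) ^ n • tprod k g n x := by
  induction n with
  | zero => simp [tprod_apply]
  | succ n ih =>
    rw [← Fin.snoc_init_self x, tprod_snoc, map_mul, ih, parity_ι, pow_succ]
    simp

theorem derivation_parity (f : g →ₗ[k] g) (u : TensorAlgebra k g) :
    derivation (ι k ∘ₗ f) (parity k g u) = parity k g (derivation (ι k ∘ₗ f) u) := by
  refine linearMap_ext_mul_ι (φ := derivation (ι k ∘ₗ f) ∘ₗ (parity k g).toLinearMap)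
    (ψ := (parity k g).toLinearMap ∘ₗ derivation (ι k ∘ₗ f)) (by simp) ?_ u
  intro u hu x
  simp only [LinearMap.comp_apply, AlgHom.toLinearMap_apply] at hu ⊢
  simp [derivation_mul, hu, add_comm]

theorem derivation_tprod (f : g →ₗ[k] g) {n : ℕ} (x : Fin n → g) :
    derivation (ι k ∘ₗ f) (tprod k g n x) =
      ∑ i, tprod k g n (Function.update x i (f (x i))) := by
  induction n with
  | zero => simp [tprod_apply]
  | succ n ih =>
    obtain ⟨w, y, rfl⟩ : ∃ (w : Fin n → g) (y : g), x = Fin.snoc w y :=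
      ⟨_, _, (Fin.snoc_init_self x).symm⟩
    rw [tprod_snoc, derivation_mul, ih, Fin.sum_univ_castSucc, Finset.sum_mul]
    congr 1
    · refine Finset.sum_congr rfl fun i _ => ?_
      rw [← tprod_snoc, Fin.snoc_update, Fin.snoc_castSucc]
    · rw [Fin.update_snoc_last, tprod_snoc, Fin.snoc_last, derivation_ι, LinearMap.comp_apply]

end

end TensorAlgebra

/-! ### Recursion for the Leibniz differential, and `d² = 0` -/

namespace LeibnizAlgebra

open TensorAlgebra

noncomputable section

variable {k : Type u} {g : Type v} [Field k] [AddCommGroup g] [Module k g] [LeibnizAlgebra k g]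

variable (k) in
/-- The derivation of `T(g)` that extends `y ↦ [x, y]`. -/
def adjointDerivation (x : g) : TensorAlgebra k g →ₗ[k] TensorAlgebra k g :=
  derivation (ι k ∘ₗ bracket (k := k) x)

@[simp]
theorem adjointDerivation_ι (x y : g) :
    adjointDerivation k x (ι k y) = ι k (bracket (k := k) x y) := by
  simp [adjointDerivation]

@[simp]
theorem adjointDerivation_one (x : g) : adjointDerivation k x (1 : TensorAlgebra k g) = 0 := by
  simp [adjointDerivation]

theorem adjointDerivation_mul (x : g) (a b : TensorAlgebra k g) :
    adjointDerivation k x (a * b) = adjointDerivation k x a * b + a * adjointDerivation k x b :=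
  derivation_mul _ a b

theorem adjointDerivation_parity (x : g) (u : TensorAlgebra k g) :
    adjointDerivation k x (parity k g u) = parity k g (adjointDerivation k x u) :=
  derivation_parity _ u

/-- A commutator of derivations is a derivation, and on generators the identity is the left Leibniz
identity. -/
theorem adjointDerivation_bracket (x y : g) (u : TensorAlgebra k g) :
    adjointDerivation k (bracket (k := k) x y) u =
      adjointDerivation k x (adjointDerivation k y u) -
        adjointDerivation k y (adjointDerivation k x u) := by
  refine linearMap_ext_mul_ι (φ := adjointDerivation k (bracket (k := k) x y))
    (ψ := adjointDerivation k x ∘ₗ adjointDerivation k y -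
      adjointDerivation k y ∘ₗ adjointDerivation k x) (by simp) ?_ u
  intro u hu z
  simp only [LinearMap.comp_apply, LinearMap.sub_apply] at hu ⊢
  simp only [adjointDerivation_mul, hu, adjointDerivation_ι, leibniz, map_add, map_sub]
  noncomm_ring

@[simp]
theorem differential_one : differential k g (1 : TensorAlgebra k g) = 0 := by
  have h : (1 : TensorAlgebra k g) = tprod k g 0 Fin.elim0 := by simp [tprod_apply]
  rw [h, differential_tprod]
  rfl

theorem removeNth_castSucc_snoc {α : Type*} {m : ℕ} (w : Fin (m + 1) → α) (x : α)
    (j : Fin (m + 1)) :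
    j.castSucc.removeNth (Fin.snoc w x : Fin (m + 2) → α) = Fin.snoc (j.removeNth w) x := by
  funext i
  refine Fin.lastCases ?_ (fun i => ?_) i
  · simp [Fin.removeNth]
  · simp only [Fin.removeNth, Fin.castSucc_succAbove_castSucc, Fin.snoc_castSucc]

/-- The terms that omit a factor of `w` give `d w * x`; those that omit the last factor `x` let it
act on each factor of `w`, giving `ad_x w` up to sign. -/
theorem differential_tprod_mul_ι {n : ℕ} (w : Fin n → g) (x : g) :
    differential k g (tprod k g n w * ι k x) =
      differential k g (tprod k g n w) * ι k x -
        adjointDerivation k x (parity k g (tprod k g n w)) := by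
  rw [← tprod_snoc, differential_tprod, differential_tprod, parity_tprod, map_smul,
    adjointDerivation, derivation_tprod]
  cases n with
  | zero => simp [differentialMultilinear]
  | succ m =>
    simp only [differentialMultilinear, sum_apply]
    rw [Fin.sum_univ_castSucc, sub_eq_add_neg, Finset.sum_mul]
    congr 1
    · refine Finset.sum_congr rfl fun j _ => ?_
      rw [Fin.sum_univ_castSucc, Finset.sum_mul]
      -- Once an earlier factor is omitted, the last position is that of `x`, which lies to the
      -- right of the omitted factor, so this term is excluded.
      rw [if_neg (by simp [Fin.lt_def]; omega), zero_apply, add_zero]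
      refine Finset.sum_congr rfl fun i _ => ?_
      simp only [Fin.castSucc_lt_castSucc_iff]
      split_ifs
      · simp only [smul_apply, smul_mul_assoc, Fin.val_castSucc]
        congr 1
        simp only [differentialTerm, MultilinearMap.coe_mk]
        rw [← tprod_snoc, Fin.snoc_update]
        congr 1
        rw [removeNth_castSucc_snoc, Fin.castSucc_succAbove_castSucc, Fin.snoc_castSucc,
          Fin.snoc_castSucc]
      · simp
    · rw [Finset.smul_sum, ← Finset.sum_neg_distrib]
      refine Finset.sum_congr rfl fun i _ => ?_
      rw [if_pos (Fin.castSucc_lt_last i)]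
      simp only [smul_apply, differentialTerm, MultilinearMap.coe_mk, Fin.val_last]
      rw [← neg_smul, pow_succ _ (m + 1)]
      simp [Fin.removeNth_last]

theorem differential_mul_ι (u : TensorAlgebra k g) (x : g) :
    differential k g (u * ι k x) =
      differential k g u * ι k x - adjointDerivation k x (parity k g u) := by
  have hu : u ∈ Submodule.span k
    {u : TensorAlgebra k g | ∃ (n : ℕ) (x : Fin n → g), u = tprod k g n x} := by
    rw [span_range_tprod]; trivial
  induction hu using Submodule.span_induction with
  | mem u hu =>
    obtain ⟨n, w, rfl⟩ := hu
    exact differential_tprod_mul_ι w x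
  | zero => simp
  | add a b _ _ ha hb => simp only [add_mul, map_add, ha, hb]; abel
  | smul c a _ ha => simp only [smul_mul_assoc, map_smul, ha, smul_sub]

@[simp]
theorem differential_ι (x : g) : differential k g (ι k x) = 0 := by
  simpa using differential_mul_ι (1 : TensorAlgebra k g) x

theorem parity_differential (u : TensorAlgebra k g) :
    parity k g (differential k g u) = -differential k g (parity k g u) := by
  refine linearMap_ext_mul_ι (φ := (parity k g).toLinearMap ∘ₗ differential k g)
    (ψ := -(differential k g ∘ₗ (parity k g).toLinearMap)) (by simp) ?_ u
  intro u hu x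
  simp only [LinearMap.comp_apply, LinearMap.neg_apply, AlgHom.toLinearMap_apply] at hu ⊢
  simp only [differential_mul_ι, map_mul, map_sub, hu, parity_ι, adjointDerivation_parity, map_neg,
    mul_neg]
  noncomm_ring

/-- In the induction step the discrepancy is `ad_x ad_y - ad_y ad_x - ad_[x,y]`, which vanishes. -/
theorem adjointDerivation_differential (x : g) (u : TensorAlgebra k g) :
    adjointDerivation k x (differential k g u) = differential k g (adjointDerivation k x u) := by
  refine linearMap_ext_mul_ι (φ := adjointDerivation k x ∘ₗ differential k g)
    (ψ := differential k g ∘ₗ adjointDerivation k x) (by simp) ?_ u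
  intro u hu y
  simp only [LinearMap.comp_apply] at hu ⊢
  simp only [differential_mul_ι, adjointDerivation_mul, map_add, map_sub, hu, adjointDerivation_ι,
    adjointDerivation_bracket, adjointDerivation_parity]
  noncomm_ring

/-- Applying the recursion twice to `u x` leaves `-ad_x (parity (d u) + d (parity u))`, which is
zero because `d` is odd. -/
theorem differential_differential (u : TensorAlgebra k g) :
    differential k g (differential k g u) = 0 := by
  refine linearMap_ext_mul_ι (φ := differential k g ∘ₗ differential k g) (ψ := 0) (by simp) ?_ u
  intro u hu x
  simp only [LinearMap.comp_apply, LinearMap.zero_apply] at hu ⊢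
  simp only [differential_mul_ι, map_sub, hu, parity_differential, adjointDerivation_differential,
    map_neg]
  simp

end

end LeibnizAlgebra

/-! ### Left-normed commutators span the free graded Lie algebra -/

namespace LeibnizAlgebra

open TensorAlgebra

noncomputable section

section LeftNormed

variable (k : Type u) (g : Type v) [Field k] [AddCommGroup g] [Module k g]

/-- `IsLeftNormed k g n z`: `z` is a linear combination of left-normed graded commutators
`⟦⋯⟦⟦x₁, x₂⟧, x₃⟧ ⋯, xₙ⟧` of elements of `g`. -/
inductive IsLeftNormed : ℕ → TensorAlgebra k g → Prop
  | of (x : g) : IsLeftNormed 1 (ι k x)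
  | zero (n : ℕ) : IsLeftNormed n 0
  | add {n : ℕ} {x y : TensorAlgebra k g} :
      IsLeftNormed n x → IsLeftNormed n y → IsLeftNormed n (x + y)
  | smul {n : ℕ} (c : k) {x : TensorAlgebra k g} : IsLeftNormed n x → IsLeftNormed n (c • x)
  | commutator_ι {n : ℕ} {x : TensorAlgebra k g} (y : g) : IsLeftNormed n x →
      IsLeftNormed (n + 1) (x * ι k y - (-1 : k) ^ n • (ι k y * x))

end LeftNormed

section

variable {k : Type u} {g : Type v} [Field k] [AddCommGroup g] [Module k g]

namespace IsLeftNormed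

theorem neg {n : ℕ} {z : TensorAlgebra k g} (h : IsLeftNormed k g n z) :
    IsLeftNormed k g n (-z) := by
  simpa using h.smul (-1)

theorem sub {n : ℕ} {y z : TensorAlgebra k g} (hy : IsLeftNormed k g n y)
    (hz : IsLeftNormed k g n z) : IsLeftNormed k g n (y - z) := by
  rw [sub_eq_add_neg]
  exact hy.add hz.neg

theorem congr {m n : ℕ} {y z : TensorAlgebra k g} (hy : IsLeftNormed k g m y) (hmn : m = n)
    (hyz : y = z) : IsLeftNormed k g n z := by
  subst hmn hyz
  exact hy

theorem eq_zero_of_degree_zero {z : TensorAlgebra k g} (h : IsLeftNormed k g 0 z) : z = 0 := by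
  generalize hn : 0 = n at h
  induction h with
  | of x => omega
  | zero n => rfl
  | add _ _ hx hy => rw [hx hn, hy hn, add_zero]
  | smul c _ hx => rw [hx hn, smul_zero]
  | commutator_ι y _ _ => omega

theorem exists_eq_ι {z : TensorAlgebra k g} (h : IsLeftNormed k g 1 z) : ∃ x : g, z = ι k x := by
  generalize hn : 1 = n at h
  induction h with
  | of x => exact ⟨x, rfl⟩
  | zero n => exact ⟨0, by simp⟩
  | add _ _ hx hy =>
    obtain ⟨x, rfl⟩ := hx hn
    obtain ⟨y, rfl⟩ := hy hn
    exact ⟨x + y, by simp⟩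
  | smul c _ hx =>
    obtain ⟨x, rfl⟩ := hx hn
    exact ⟨c • x, by simp⟩
  | commutator_ι y hx _ =>
    obtain rfl := Nat.succ.inj hn
    exact ⟨0, by simp [hx.eq_zero_of_degree_zero]⟩

theorem parity_eq {n : ℕ} {z : TensorAlgebra k g} (h : IsLeftNormed k g n z) :
    parity k g z = (-1 : k) ^ n • z := by
  induction h with
  | of x => simp
  | zero n => simp
  | add _ _ hx hy => rw [map_add, hx, hy, smul_add]
  | smul c _ hx => rw [map_smul, hx, smul_comm]
  | commutator_ι y _ hx =>
    simp [hx, pow_succ, smul_sub, smul_neg]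

/-- Induction on elements of degree at least two. -/
theorem induction_two {P : ℕ → TensorAlgebra k g → Prop}
    (zero : ∀ n, P (n + 2) 0)
    (add : ∀ n x y, P (n + 2) x → P (n + 2) y → P (n + 2) (x + y))
    (smul : ∀ n (c : k) x, P (n + 2) x → P (n + 2) (c • x))
    (base : ∀ x y : g, P 2 (ι k x * ι k y + ι k y * ι k x))
    (step : ∀ n x (y : g), IsLeftNormed k g (n + 2) x → P (n + 2) x →
      P (n + 3) (x * ι k y - (-1 : k) ^ (n + 2) • (ι k y * x)))
    {n : ℕ} {z : TensorAlgebra k g} (h : IsLeftNormed k g (n + 2) z) : P (n + 2) z := by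
  generalize hm : n + 2 = m at h
  induction h generalizing n with
  | of x => omega
  | zero m => exact hm ▸ zero n
  | add _ _ hx hy => subst hm; exact add _ _ _ (hx rfl) (hy rfl)
  | smul c _ hx => subst hm; exact smul _ c _ (hx rfl)
  | @commutator_ι m x y h hx =>
    obtain rfl | ⟨l, rfl⟩ : m = 1 ∨ ∃ l, m = l + 2 := by
      rcases n with _ | n
      · left; omega
      · right; exact ⟨n, by omega⟩
    · obtain ⟨x, rfl⟩ := h.exists_eq_ι
      simpa using base x y
    · exact step l x y h (hx rfl)

theorem commutator {p q : ℕ} {a b : TensorAlgebra k g} (ha : IsLeftNormed k g p a)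
    (hb : IsLeftNormed k g q b) :
    IsLeftNormed k g (p + q) (a * b - (-1 : k) ^ (p * q) • (b * a)) := by
  induction hb generalizing p a with
  | of y => simpa using ha.commutator_ι y
  | zero n => simpa using zero (p + n)
  | add _ _ hx hy =>
    refine ((hx ha).add (hy ha)).congr rfl ?_
    simp only [mul_add, add_mul, smul_add]
    abel
  | smul c _ hx =>
    refine ((hx ha).smul c).congr rfl ?_
    simp only [smul_sub, mul_smul_comm, smul_mul_assoc]
    rw [smul_comm]
  | @commutator_ι n w y hw ih =>
    -- Graded Jacobi: `⟦a, ⟦w, y⟧⟧ = ⟦⟦a, w⟧, y⟧ - (-1)ⁿ ⟦⟦a, y⟧, w⟧`, with `w` of degree `n`; the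
    -- induction hypothesis is used for `a` and for `⟦a, y⟧`.
    have h1 := (ih ha).commutator_ι y
    have h2 := ((ih (ha.commutator_ι y)).smul ((-1 : k) ^ n)).congr
      (show p + 1 + n = p + n + 1 by omega) rfl
    refine (h1.sub h2).congr (add_assoc _ _ _) ?_
    rcases Nat.even_or_odd p with hp | hp <;> rcases Nat.even_or_odd n with hn | hn <;>
      simp [pow_add, pow_mul, mul_add, add_mul, hp.neg_one_pow, hn.neg_one_pow] <;>
      noncomm_ring

theorem isLieElement {n : ℕ} {z : TensorAlgebra k g} (h : IsLeftNormed k g n z) :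
    IsLieElement k g n z := by
  induction h with
  | of x => exact .of x
  | zero n => exact .zero n
  | add _ _ hx hy => exact hx.add hy
  | smul c _ hx => exact hx.smul c
  | commutator_ι y _ hx => simpa using hx.commutator (.of y)

theorem derivation {n : ℕ} {z : TensorAlgebra k g} (h : IsLeftNormed k g n z) (f : g →ₗ[k] g) :
    IsLeftNormed k g n (TensorAlgebra.derivation (ι k ∘ₗ f) z) := by
  induction h with
  | of x => simpa using of (f x)
  | zero n => simpa using zero n
  | add _ _ hx hy => simpa using hx.add hy
  | smul c _ hx => simpa using hx.smul c
  | commutator_ι y h hx =>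
    refine ((hx.commutator_ι y).add (h.commutator_ι (f y))).congr rfl ?_
    simp only [map_sub, map_smul, derivation_mul, derivation_ι, LinearMap.comp_apply]
    simp only [smul_add]
    abel

/-- A skew derivation that maps `g` to graded commutators of degree two raises the degree of Lie
elements by one. -/
theorem twistedDerivation_parity {n : ℕ} {z : TensorAlgebra k g} (h : IsLeftNormed k g n z)
    {f : g →ₗ[k] TensorAlgebra k g} (hf : ∀ x, IsLeftNormed k g 2 (f x)) :
    IsLeftNormed k g (n + 1) (twistedDerivation (parity k g) f z) := by
  induction h with
  | of x => simpa using hf x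
  | zero n => simpa using zero (n + 1)
  | add _ _ hx hy => simpa using hx.add hy
  | smul c _ hx => simpa using hx.smul c
  | @commutator_ι n x y h hx =>
    refine ((hx.commutator_ι y).add ((h.commutator (hf y)).smul ((-1 : k) ^ n))).congr rfl ?_
    simp only [map_sub, map_smul, twistedDerivation_mul, twistedDerivation_ι, parity_ι, h.parity_eq]
    rcases Nat.even_or_odd n with hn | hn <;>
      simp [pow_add, pow_mul, hn.neg_one_pow] <;> noncomm_ring

end IsLeftNormed

theorem IsLieElement.isLeftNormed {n : ℕ} {z : TensorAlgebra k g} (h : IsLieElement k g n z) :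
    IsLeftNormed k g n z := by
  induction h with
  | of x => exact .of x
  | zero n => exact .zero n
  | add _ _ hx hy => exact hx.add hy
  | smul c _ hx => exact hx.smul c
  | commutator _ _ hx hy => exact hx.commutator hy

theorem mem_freeLie_iff {n : ℕ} {z : TensorAlgebra k g} :
    z ∈ freeLie k g n ↔ IsLeftNormed k g n z :=
  ⟨IsLieElement.isLeftNormed, IsLeftNormed.isLieElement⟩

end

/-! ### The differential on Lie elements -/

section Differential

variable {k : Type u} {g : Type v} [Field k] [AddCommGroup g] [Module k g] [LeibnizAlgebra k g]

/-- The obstruction to the Leibniz rule for `u x y` contains `ad_y (parity u) x - ad_x (parity u)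
y`, which is antisymmetric in `x`, `y` and so cancels in the commutator. -/
theorem differential_mul_commutator_ι_ι (u : TensorAlgebra k g) (x y : g) :
    differential k g (u * (ι k x * ι k y + ι k y * ι k x)) =
      differential k g u * (ι k x * ι k y + ι k y * ι k x) +
        parity k g u * ι k (bracket (k := k) x y + bracket (k := k) y x) := by
  simp only [mul_add, ← mul_assoc, map_add, differential_mul_ι, map_mul, parity_ι,
    mul_neg, map_neg, adjointDerivation_mul, adjointDerivation_ι]
  noncomm_ring

theorem differential_commutator_ι_ι (x y : g) :
    differential k g (ι k x * ι k y + ι k y * ι k x) =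
      ι k (bracket (k := k) x y + bracket (k := k) y x) := by
  simpa using differential_mul_commutator_ι_ι (1 : TensorAlgebra k g) x y

/-- The differential satisfies the graded Leibniz rule on products whose right factor is a Lie
element of degree at least two. -/
theorem IsLeftNormed.differential_mul {n : ℕ} {z : TensorAlgebra k g}
    (h : IsLeftNormed k g (n + 2) z) (u : TensorAlgebra k g) :
    differential k g (u * z) = differential k g u * z + parity k g u * differential k g z := by
  revert u
  refine IsLeftNormed.induction_two (P := fun _ z => ∀ u : TensorAlgebra k g,
    differential k g (u * z) = differential k g u * z + parity k g u * differential k g z)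
    ?_ ?_ ?_ ?_ ?_ h
  · intro n u
    simp
  · intro n x y hx hy u
    simp only [mul_add, map_add, hx, hy]
    abel
  · intro n c x hx u
    simp only [mul_smul_comm, map_smul, hx, smul_add]
  · intro x y u
    rw [differential_mul_commutator_ι_ι, differential_commutator_ι_ι]
  -- The two occurrences of `ad_y (parity u) * x`, from `d (u x y)` and from `d (u y) * x`, cancel
  -- because `parity x = (-1)ⁿ x`.
  · intro n x y hx ih u
    simp only [mul_sub, mul_smul_comm, ← mul_assoc, map_sub, map_smul, differential_mul_ι, ih]
    simp only [map_mul, parity_ι, hx.parity_eq, adjointDerivation_mul, map_smul, mul_smul_comm]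
    rcases Nat.even_or_odd n with hn | hn <;>
      simp [pow_add, hn.neg_one_pow] <;> noncomm_ring

/-- The recursion for `d` along left-normed commutators. Its correction term is again a Lie element,
of the degree of `z`. -/
theorem IsLeftNormed.differential_commutator_ι {n : ℕ} {z : TensorAlgebra k g}
    (h : IsLeftNormed k g (n + 2) z) (y : g) :
    differential k g (z * ι k y - (-1 : k) ^ (n + 2) • (ι k y * z)) =
      differential k g z * ι k y - (-1 : k) ^ (n + 1) • (ι k y * differential k g z) -
        (-1 : k) ^ n • adjointDerivation k y z := by
  simp only [map_sub, map_smul, differential_mul_ι, h.differential_mul, h.parity_eq,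
    differential_ι, parity_ι]
  rcases Nat.even_or_odd n with hn | hn <;>
    simp [pow_add, hn.neg_one_pow] <;> noncomm_ring

theorem IsLeftNormed.differential_two {n : ℕ} {z : TensorAlgebra k g}
    (h : IsLeftNormed k g (n + 2) z) : IsLeftNormed k g (n + 1) (differential k g z) := by
  refine IsLeftNormed.induction_two (P := fun m z => ∀ n, n + 1 = m →
    IsLeftNormed k g n (differential k g z)) ?_ ?_ ?_ ?_ ?_ h (n + 1) rfl
  · intro n m _
    simpa using IsLeftNormed.zero m
  · intro n x y hx hy m hm
    simpa using (hx m hm).add (hy m hm)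
  · intro n c x hx m hm
    simpa using (hx m hm).smul c
  · intro x y m hm
    obtain rfl : m = 1 := by omega
    rw [differential_commutator_ι_ι]
    exact .of _
  · intro n x y hx ih m hm
    obtain rfl : m = n + 2 := by omega
    rw [hx.differential_commutator_ι]
    exact ((ih (n + 1) rfl).commutator_ι y).sub ((hx.derivation _).smul _)

variable (k g) in
theorem map_differential_freeLie_le (n : ℕ) :
    (freeLie k g (n + 1)).map (differential k g) ≤ freeLie k g n := by
  rintro _ ⟨z, hz, rfl⟩
  have hz := mem_freeLie_iff.1 hz
  rw [mem_freeLie_iff]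
  cases n with
  | zero =>
    obtain ⟨x, rfl⟩ := hz.exists_eq_ι
    simpa using IsLeftNormed.zero 0
  | succ n => exact hz.differential_two

end Differential

end

end LeibnizAlgebra

namespace LeibnizAlgebra

open TensorAlgebra

noncomputable section

/-! ### Free Leibniz algebras -/

section UniversalProperty

variable {k : Type u} {g : Type v} [Field k] [AddCommGroup g] [Module k g] [LeibnizAlgebra k g]

/-- Transport of the structure of a Leibniz algebra along a linear isomorphism. -/
abbrev ofLinearEquiv {h h' : Type*} [AddCommGroup h] [Module k h] [LeibnizAlgebra k h]
    [AddCommGroup h'] [Module k h'] (e : h' ≃ₗ[k] h) : LeibnizAlgebra k h' where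
  bracket := (bracket (k := k) (g := h)).compr₂ e.symm.toLinearMap |>.compl₁₂ e.toLinearMap
    e.toLinearMap
  leibniz x y z := by simp [leibniz]

/-- The universal property of a free Leibniz algebra with respect to all algebras of the relevant
size. -/
theorem IsFreeOn.existsUnique_lift {X : Type w} {b : X → g} (hb : IsFreeOn k b) (h : Type*)
    [Small.{max u v w} h] [AddCommGroup h] [Module k h] [LeibnizAlgebra k h] (f : X → h) :
    ∃! φ : g →ₗ[k] h,
      (∀ x y : g, φ (bracket (k := k) x y) = bracket (k := k) (φ x) (φ y)) ∧
        ∀ x : X, φ (b x) = f x := by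
  let e : Shrink.{max u v w} h ≃ₗ[k] h := Shrink.linearEquiv k h
  let : LeibnizAlgebra k (Shrink.{max u v w} h) := ofLinearEquiv e
  have hbr (x y : Shrink.{max u v w} h) :
      e (bracket (k := k) x y) = bracket (k := k) (e x) (e y) := by
    change e (e.symm _) = _
    simp
  obtain ⟨φ, ⟨h1, h2⟩, h3⟩ := hb (Shrink.{max u v w} h) fun x => e.symm (f x)
  refine ⟨e.toLinearMap ∘ₗ φ, ⟨fun x y => ?_, fun x => ?_⟩, fun ψ hψ => ?_⟩
  · simp [h1, hbr]
  · simp [h2]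
  · rw [← h3 (e.symm.toLinearMap ∘ₗ ψ) ⟨fun x y => e.injective ?_, fun x => ?_⟩]
    · ext; simp
    · rw [hbr]
      simp [hψ.1]
    · simp [hψ.2]

/-- A homomorphism from a free Leibniz algebra to itself that fixes the generators is the
identity. -/
theorem IsFreeOn.eq_id {X : Type w} {b : X → g} (hb : IsFreeOn k b) (φ : g →ₗ[k] g)
    (hφ : ∀ x y : g, φ (bracket (k := k) x y) = bracket (k := k) (φ x) (φ y))
    (hφb : ∀ x, φ (b x) = b x) : φ = LinearMap.id := by
  have : Small.{max u v w} g := ⟨ULift.{max u w} g, ⟨Equiv.ulift.symm⟩⟩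
  exact (hb.existsUnique_lift g b).unique ⟨hφ, hφb⟩ ⟨fun _ _ => rfl, fun _ => rfl⟩

/-- A Leibniz subalgebra of a free Leibniz algebra that contains the generators is everything. -/
theorem IsFreeOn.eq_top {X : Type w} {b : X → g} (hb : IsFreeOn k b) {S : Submodule k g}
    (hbS : ∀ x, b x ∈ S) (hS : ∀ x ∈ S, ∀ y ∈ S, bracket (k := k) x y ∈ S) : S = ⊤ := by
  have : Small.{max u v w} S := ⟨ULift.{max u w} S, ⟨Equiv.ulift.symm⟩⟩
  let : LeibnizAlgebra k S :=
    { bracket := LinearMap.mk₂ k (fun x y => ⟨bracket (k := k) x.1 y.1, hS _ x.2 _ y.2⟩)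
        (fun x y z => by ext; simp) (fun c x y => by ext; simp)
        (fun x y z => by ext; simp) (fun c x y => by ext; simp)
      leibniz := fun x y z => by ext; simp [leibniz] }
  have hbr (x y : S) : ((bracket (k := k) x y : S) : g) = bracket (k := k) (x : g) (y : g) := rfl
  obtain ⟨φ, ⟨h1, h2⟩, -⟩ := hb.existsUnique_lift S fun x => ⟨b x, hbS x⟩
  -- The lift to `S` followed by the inclusion fixes the generators, so it is the identity and every
  -- element lies in `S`.
  have h3 := hb.eq_id (S.subtype ∘ₗ φ) (fun x y => by simp [h1, hbr]) (fun x => by simp [h2])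
  refine eq_top_iff.2 fun x _ => ?_
  rw [show x = S.subtype (φ x) from (LinearMap.congr_fun h3 x).symm]
  exact (φ x).2

theorem IsFreeOn.induction {X : Type w} {b : X → g} (hb : IsFreeOn k b) {P : g → Prop}
    (zero : P 0) (add : ∀ x y, P x → P y → P (x + y)) (smul : ∀ (c : k) x, P x → P (c • x))
    (gen : ∀ x, P (b x)) (br : ∀ x y, P x → P y → P (bracket (k := k) x y)) (x : g) : P x := by
  let S : Submodule k g :=
    { carrier := {x | P x}
      add_mem' := fun hx hy => add _ _ hx hy
      zero_mem' := zero
      smul_mem' := fun c _ hx => smul c _ hx }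
  have h : S = ⊤ := hb.eq_top (S := S) gen fun x hx y hy => br x y hx hy
  exact (h ▸ Submodule.mem_top : x ∈ S)

end UniversalProperty

/-! ### Construction of `σ`, `N` and `s` by an extension of `g` -/

section Extension

variable {k : Type u} {g : Type v} [Field k] [AddCommGroup g] [Module k g]

/-- The graded commutator of two elements of `g` in `T(g)`. -/
def symmetricBracket : g →ₗ[k] g →ₗ[k] TensorAlgebra k g :=
  LinearMap.mk₂ k (fun x y => ι k x * ι k y + ι k y * ι k x)
    (fun x y z => by simp only [map_add, add_mul, mul_add]; abel) (fun c x y => by simp)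
    (fun x y z => by simp only [map_add, add_mul, mul_add]; abel) (fun c x y => by simp)

theorem symmetricBracket_apply (x y : g) :
    symmetricBracket (k := k) x y = ι k x * ι k y + ι k y * ι k x := rfl

theorem isLeftNormed_symmetricBracket (x y : g) :
    IsLeftNormed k g 2 (symmetricBracket (k := k) x y) :=
  ((IsLeftNormed.of x).commutator_ι y).congr rfl (by simp [symmetricBracket_apply])

variable [LeibnizAlgebra k g]

theorem differential_symmetricBracket (x y : g) :
    differential k g (symmetricBracket (k := k) x y) =
      ι k (bracket (k := k) x y + bracket (k := k) y x) :=
  differential_commutator_ι_ι x y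

theorem adjointDerivation_symmetricBracket (x y z : g) :
    adjointDerivation k x (symmetricBracket (k := k) y z) =
      symmetricBracket (bracket (k := k) x y) z + symmetricBracket y (bracket (k := k) x z) := by
  simp only [symmetricBracket_apply, map_add, adjointDerivation_mul, adjointDerivation_ι]
  abel

theorem adjointDerivation_add (x y : g) (u : TensorAlgebra k g) :
    adjointDerivation k (x + y) u = adjointDerivation k x u + adjointDerivation k y u := by
  refine linearMap_ext_mul_ι (φ := adjointDerivation k (x + y))
    (ψ := adjointDerivation k x + adjointDerivation k y) (by simp) ?_ u
  intro u hu z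
  simp only [LinearMap.add_apply] at hu ⊢
  simp only [adjointDerivation_mul, hu, adjointDerivation_ι, map_add, LinearMap.add_apply, add_mul,
    mul_add]
  abel

theorem adjointDerivation_smul (c : k) (x : g) (u : TensorAlgebra k g) :
    adjointDerivation k (c • x) u = c • adjointDerivation k x u := by
  refine linearMap_ext_mul_ι (φ := adjointDerivation k (c • x))
    (ψ := c • adjointDerivation k x) (by simp) ?_ u
  intro u hu z
  simp only [LinearMap.smul_apply] at hu ⊢
  simp only [adjointDerivation_mul, hu, adjointDerivation_ι, map_smul, LinearMap.smul_apply,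
    smul_mul_assoc, mul_smul_comm, smul_add]

variable (k g) in
/-- The bracket on `g × g × g × T(g)` for which a homomorphism `(id, σ, N, s)` from `g` consists of
a crossed derivation `σ`, a derivation `N`, and a map `s` that is compatible with `σ`. -/
abbrev extensionAlgebra : LeibnizAlgebra k (g × g × g × TensorAlgebra k g) where
  bracket := LinearMap.mk₂ k
    (fun a b => (bracket (k := k) a.1 b.1,
      bracket (k := k) a.1 b.2.1 - bracket (k := k) b.1 a.2.1,
      bracket (k := k) a.1 b.2.2.1 + bracket (k := k) a.2.2.1 b.1,
      symmetricBracket a.2.1 b.1 + adjointDerivation k a.1 b.2.2.2))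
    (fun a b c => by
      simp only [Prod.fst_add, Prod.snd_add, map_add, LinearMap.add_apply, adjointDerivation_add,
        Prod.mk_add_mk, Prod.mk.injEq]
      refine ⟨trivial, ?_, ?_, ?_⟩ <;> abel)
    (fun r a b => by
      simp only [Prod.smul_fst, Prod.smul_snd, map_smul, LinearMap.smul_apply,
        adjointDerivation_smul, Prod.smul_mk, smul_add, smul_sub])
    (fun a b c => by
      simp only [Prod.fst_add, Prod.snd_add, map_add, LinearMap.add_apply,
        Prod.mk_add_mk, Prod.mk.injEq]
      refine ⟨trivial, ?_, ?_, ?_⟩ <;> abel)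
    (fun r a b => by
      simp only [Prod.smul_fst, Prod.smul_snd, map_smul, LinearMap.smul_apply,
        Prod.smul_mk, smul_add, smul_sub])
  -- In the last coordinate, `ad` expands the symmetric bracket by the derivation rule; the terms
  -- pairing `a.2.1` with `[b, c]` and `b.2.1` with `[a, c]` cancel, and the crossed rule in the
  -- second coordinate accounts for the rest.
  leibniz a b c := by
    simp only [LinearMap.mk₂_apply, Prod.mk_sub_mk, Prod.mk.injEq, leibniz, map_add, map_sub,
      LinearMap.add_apply, LinearMap.sub_apply, adjointDerivation_bracket,
      adjointDerivation_symmetricBracket]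
    refine ⟨trivial, ?_, ?_, ?_⟩ <;> abel

/-- The data from which the contracting homotopy is built: a crossed derivation `σ`, a derivation
`N` and a map `s` to the graded commutators of degree two, with prescribed values on generators. -/
structure ContractionData {X : Type w} (b : X → g) where
  /-- the crossed derivation -/
  σ : g →ₗ[k] g
  /-- the derivation that counts the generators in a bracket -/
  N : g →ₗ[k] g
  /-- the homotopy on `g` -/
  s : g →ₗ[k] TensorAlgebra k g
  σ_gen : ∀ x, σ (b x) = b x
  N_gen : ∀ x, N (b x) = b x
  s_gen : ∀ x, s (b x) = 0
  σ_bracket : ∀ x y,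
    σ (bracket (k := k) x y) = bracket (k := k) x (σ y) - bracket (k := k) y (σ x)
  N_bracket : ∀ x y,
    N (bracket (k := k) x y) = bracket (k := k) x (N y) + bracket (k := k) (N x) y
  s_bracket : ∀ x y,
    s (bracket (k := k) x y) = symmetricBracket (σ x) y + adjointDerivation k x (s y)

/-- Freeness gives a homomorphism to the extension with `b x ↦ (b x, b x, b x, 0)`. Its first
coordinate is the identity, so the other coordinates satisfy the required rules. -/
theorem IsFreeOn.nonempty_contractionData {X : Type w} {b : X → g} (hb : IsFreeOn k b) :
    Nonempty (ContractionData (k := k) b) := by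
  let _ : LeibnizAlgebra k (g × g × g × TensorAlgebra k g) := extensionAlgebra k g
  have : Small.{max u v w} (g × g × g × TensorAlgebra k g) :=
    ⟨ULift.{w} (g × g × g × TensorAlgebra k g), ⟨Equiv.ulift.symm⟩⟩
  obtain ⟨φ, ⟨h1, h2⟩, -⟩ := hb.existsUnique_lift (g × g × g × TensorAlgebra k g)
    fun x => (b x, b x, b x, 0)
  have hbr (a b : g × g × g × TensorAlgebra k g) : bracket (k := k) a b =
      (bracket (k := k) a.1 b.1,
        bracket (k := k) a.1 b.2.1 - bracket (k := k) b.1 a.2.1,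
        bracket (k := k) a.1 b.2.2.1 + bracket (k := k) a.2.2.1 b.1,
        symmetricBracket a.2.1 b.1 + adjointDerivation k a.1 b.2.2.2) := rfl
  simp only [hbr] at h1
  have hid : ∀ x, (φ x).1 = x := LinearMap.congr_fun
    (hb.eq_id (LinearMap.fst k _ _ ∘ₗ φ) (fun x y => by simp [h1]) (fun x => by simp [h2]))
  simp only [hid] at h1
  exact ⟨{
    σ := LinearMap.fst k _ _ ∘ₗ LinearMap.snd k _ _ ∘ₗ φ
    N := LinearMap.fst k _ _ ∘ₗ LinearMap.snd k _ _ ∘ₗ LinearMap.snd k _ _ ∘ₗ φ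
    s := LinearMap.snd k _ _ ∘ₗ LinearMap.snd k _ _ ∘ₗ LinearMap.snd k _ _ ∘ₗ φ
    σ_gen := fun x => by simp [h2]
    N_gen := fun x => by simp [h2]
    s_gen := fun x => by simp [h2]
    σ_bracket := fun x y => by simp [h1]
    N_bracket := fun x y => by simp [h1]
    s_bracket := fun x y => by simp [h1] }⟩

end Extension

/-! ### The contracting homotopy -/

namespace ContractionData

variable {k : Type u} {g : Type v} [Field k] [AddCommGroup g] [Module k g] [LeibnizAlgebra k g]
  {X : Type w} {b : X → g} (c : ContractionData (k := k) b)

theorem isLeftNormed_s (hb : IsFreeOn k b) (x : g) : IsLeftNormed k g 2 (c.s x) := by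
  induction x using hb.induction with
  | zero => simpa using IsLeftNormed.zero 2
  | add x y hx hy => simpa using hx.add hy
  | smul r x hx => simpa using hx.smul r
  | gen x => simpa [c.s_gen] using IsLeftNormed.zero 2
  | br x y hx hy =>
    rw [c.s_bracket]
    exact (isLeftNormed_symmetricBracket _ _).add (hy.derivation _)

/-- Elements acting trivially from the left include all `[x, y] + [y, x]` and are stable under `[x,
·]`. Modulo them, `N` and `σ` agree on brackets as soon as they agree on the factors. -/
theorem bracket_N_sub_σ (hb : IsFreeOn k b) (x z : g) :
    bracket (k := k) (c.N x - c.σ x) z = 0 := by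
  induction x using hb.induction generalizing z with
  | zero => simp
  | add x y hx hy =>
    rw [map_add, map_add, add_sub_add_comm, map_add, LinearMap.add_apply, hx, hy, add_zero]
  | smul r x hx => rw [map_smul, map_smul, ← smul_sub, map_smul, LinearMap.smul_apply, hx, smul_zero]
  | gen x => simp [c.N_gen, c.σ_gen]
  | br x y hx hy =>
    have hx' (z) : bracket (k := k) (c.N x) z = bracket (k := k) (c.σ x) z := by
      simpa [sub_eq_zero] using hx z
    have hy' (z) : bracket (k := k) (c.N y) z = bracket (k := k) (c.σ y) z := by
      simpa [sub_eq_zero] using hy z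
    simp only [c.N_bracket, c.σ_bracket, map_add, map_sub, LinearMap.add_apply, LinearMap.sub_apply,
      leibniz, hx', hy']
    abel

/-- On `[x, y]` the left side is `[σ x, y] + [y, σ x] + [x, N y - σ y]`; replacing `[σ x, y]` by `[N
x, y]` gives the right side. -/
theorem differential_s (hb : IsFreeOn k b) (x : g) :
    differential k g (c.s x) = ι k (c.N x) - ι k (c.σ x) := by
  induction x using hb.induction with
  | zero => simp
  | add x y hx hy => simp only [map_add, hx, hy]; abel
  | smul r x hx => simp only [map_smul, hx, smul_sub]
  | gen x => simp [c.s_gen, c.N_gen, c.σ_gen]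
  | br x y hx hy =>
    have hx' : bracket (k := k) (c.N x) y = bracket (k := k) (c.σ x) y := by
      simpa [sub_eq_zero] using c.bracket_N_sub_σ hb x y
    simp only [c.s_bracket, map_add, differential_symmetricBracket,
      ← adjointDerivation_differential, hy, c.N_bracket, c.σ_bracket, map_sub, adjointDerivation_ι,
      hx']
    abel

/-- The extension of `s` to a skew derivation of `T(g)`. -/
def homotopy : TensorAlgebra k g →ₗ[k] TensorAlgebra k g := twistedDerivation (parity k g) c.s

/-- The extension of `N` to a derivation of `T(g)`. -/
def weight : TensorAlgebra k g →ₗ[k] TensorAlgebra k g := derivation (ι k ∘ₗ c.N)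

@[simp]
theorem homotopy_ι (x : g) : c.homotopy (ι k x) = c.s x := twistedDerivation_ι _ _ x

theorem homotopy_mul (a a' : TensorAlgebra k g) :
    c.homotopy (a * a') = c.homotopy a * a' + parity k g a * c.homotopy a' :=
  twistedDerivation_mul _ _ a a'

@[simp]
theorem weight_ι (x : g) : c.weight (ι k x) = ι k (c.N x) := derivation_ι _ x

theorem weight_mul (a a' : TensorAlgebra k g) :
    c.weight (a * a') = c.weight a * a' + a * c.weight a' :=
  derivation_mul _ a a'

/-- The rule for `s` on brackets is this formula on generators; the last term is the graded
commutator with `σ x`, itself a skew derivation in `u`. -/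
theorem homotopy_adjointDerivation (x : g) (u : TensorAlgebra k g) :
    c.homotopy (adjointDerivation k x u) = adjointDerivation k x (c.homotopy u) +
      (ι k (c.σ x) * u - parity k g u * ι k (c.σ x)) := by
  refine linearMap_ext_mul_ι (φ := c.homotopy ∘ₗ adjointDerivation k x)
    (ψ := adjointDerivation k x ∘ₗ c.homotopy + (LinearMap.mulLeft k (ι k (c.σ x)) -
      LinearMap.mulRight k (ι k (c.σ x)) ∘ₗ (parity k g).toLinearMap))
    (by simp [homotopy]) ?_ u
  intro u hu y
  simp only [LinearMap.comp_apply, LinearMap.add_apply, LinearMap.sub_apply,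
    LinearMap.mulLeft_apply, LinearMap.mulRight_apply, AlgHom.toLinearMap_apply] at hu ⊢
  simp only [adjointDerivation_mul, homotopy_mul, map_add, hu, adjointDerivation_ι, homotopy_ι,
    c.s_bracket, adjointDerivation_parity, map_mul, parity_ι, symmetricBracket_apply]
  noncomm_ring

theorem isLeftNormed_homotopy (hb : IsFreeOn k b) {n : ℕ} {z : TensorAlgebra k g}
    (h : IsLeftNormed k g n z) : IsLeftNormed k g (n + 1) (c.homotopy z) :=
  h.twistedDerivation_parity (c.isLeftNormed_s hb)

/-- On `g` itself the left side would be `N - σ`. In higher degree the unwanted `⟦z, σ y⟧` coming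
from `d (s y)` is cancelled by the commutator with `σ y` that arises when the homotopy passes `ad_y
z` in `d ⟦z, y⟧`. -/
theorem homotopy_differential_add (hb : IsFreeOn k b) {n : ℕ} {z : TensorAlgebra k g}
    (h : IsLeftNormed k g (n + 2) z) :
    c.homotopy (differential k g z) + differential k g (c.homotopy z) = c.weight z := by
  refine IsLeftNormed.induction_two (P := fun _ z =>
    c.homotopy (differential k g z) + differential k g (c.homotopy z) = c.weight z)
    ?_ ?_ ?_ ?_ ?_ h
  · intro n
    simp
  · intro n x y hx hy
    simp only [map_add, ← hx, ← hy]
    abel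
  · intro n r x hx
    simp only [map_smul, ← hx, smul_add]
  · intro x y
    have hx := c.isLeftNormed_s hb x
    have hy := c.isLeftNormed_s hb y
    simp only [homotopy_ι, map_add, homotopy_mul, parity_ι, differential_mul_ι, hx.parity_eq,
      hy.parity_eq, neg_mul, map_neg, hx.differential_mul, hy.differential_mul,
      c.differential_s hb, weight_mul, weight_ι, differential_ι]
    simp [c.s_bracket, symmetricBracket_apply]
    noncomm_ring
  · intro n x y hx ih
    have hy := c.isLeftNormed_s hb y
    have hsx := c.isLeftNormed_homotopy hb hx
    have hdx := hx.differential_two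
    have ih' := eq_sub_of_add_eq ih
    -- Since `s y` has even degree, its graded commutator with `x` is the ordinary one.
    have e : c.homotopy (x * ι k y - (-1 : k) ^ (n + 2) • (ι k y * x)) =
        (c.homotopy x * ι k y - (-1 : k) ^ (n + 1 + 2) • (ι k y * c.homotopy x)) +
          (-1 : k) ^ n • (x * c.s y - c.s y * x) := by
      simp only [map_sub, map_smul, homotopy_mul, homotopy_ι, hx.parity_eq, parity_ι]
      rcases Nat.even_or_odd n with hn | hn <;> simp [pow_add, hn.neg_one_pow] <;> noncomm_ring
    rw [e, map_add, IsLeftNormed.differential_commutator_ι (n := n + 1) hsx,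
      hx.differential_commutator_ι]
    simp only [map_sub, map_smul, homotopy_mul, homotopy_ι, parity_ι, hdx.parity_eq,
      hx.differential_mul, hy.differential_mul, hx.parity_eq, hy.parity_eq,
      c.differential_s hb, c.homotopy_adjointDerivation, weight_mul, weight_ι, ih']
    rcases Nat.even_or_odd n with hn | hn <;> simp [pow_add, hn.neg_one_pow] <;> noncomm_ring

end ContractionData

end

end LeibnizAlgebra

/-! ### Positivity of the weight, and vanishing of homology -/

namespace LeibnizAlgebra

open TensorAlgebra

noncomputable section

namespace ContractionData

variable {k : Type u} {g : Type v} [Field k] [AddCommGroup g] [Module k g] [LeibnizAlgebra k g]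
  {X : Type w} {b : X → g} (c : ContractionData (k := k) b)

/-- `g` is spanned by elements of positive integral weight. -/
theorem span_N_eigenvectors (hb : IsFreeOn k b) :
    Submodule.span k {x : g | ∃ m : ℕ, c.N x = ((m + 1 : ℕ) : k) • x} = ⊤ := by
  refine hb.eq_top (fun x => Submodule.subset_span ⟨0, by simp [c.N_gen]⟩) fun x hx y hy => ?_
  induction hx, hy using Submodule.span_induction₂ with
  | mem_mem x y hx hy =>
    obtain ⟨m, hm⟩ := hx
    obtain ⟨n, hn⟩ := hy
    -- Weights are stored as `m + 1`, and `(m + 1) + (n + 1) = (m + n + 1) + 1`.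
    refine Submodule.subset_span ⟨m + n + 1, ?_⟩
    rw [c.N_bracket, hm, hn, map_smul, map_smul, LinearMap.smul_apply, ← add_smul, ← Nat.cast_add]
    congr 2
    omega
  | zero_left y hy => simp
  | zero_right x hx => simp
  | add_left x y z hx hy hz h1 h2 => simpa using Submodule.add_mem _ h1 h2
  | add_right x y z hx hy hz h1 h2 => simpa using Submodule.add_mem _ h1 h2
  | smul_left r x y hx hy h => simpa using Submodule.smul_mem _ r h
  | smul_right r x y hx hy h => simpa using Submodule.smul_mem _ r h

/-- The span of the elements of `T(g)` of positive integral weight. -/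
def positiveWeight : Submodule k (TensorAlgebra k g) :=
  Submodule.span k {u | ∃ m : ℕ, c.weight u = ((m + 1 : ℕ) : k) • u}

theorem ι_mem_positiveWeight (hb : IsFreeOn k b) (x : g) : ι k x ∈ c.positiveWeight := by
  have hx : x ∈ Submodule.span k {x : g | ∃ m : ℕ, c.N x = ((m + 1 : ℕ) : k) • x} := by
    rw [c.span_N_eigenvectors hb]; trivial
  induction hx using Submodule.span_induction with
  | mem x hx =>
    obtain ⟨m, hm⟩ := hx
    exact Submodule.subset_span ⟨m, by rw [weight_ι, hm, map_smul]⟩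
  | zero => simp
  | add x y _ _ hx hy => simpa using Submodule.add_mem _ hx hy
  | smul r x _ hx => simpa using Submodule.smul_mem _ r hx

theorem mul_mem_positiveWeight {x y : TensorAlgebra k g} (hx : x ∈ c.positiveWeight)
    (hy : y ∈ c.positiveWeight) : x * y ∈ c.positiveWeight := by
  rw [positiveWeight] at hx hy ⊢
  induction hx, hy using Submodule.span_induction₂ with
  | mem_mem x y hx hy =>
    obtain ⟨m, hm⟩ := hx
    obtain ⟨n, hn⟩ := hy
    refine Submodule.subset_span ⟨m + n + 1, ?_⟩
    rw [weight_mul, hm, hn, smul_mul_assoc, mul_smul_comm, ← add_smul, ← Nat.cast_add]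
    congr 2
    omega
  | zero_left y hy => simp
  | zero_right x hx => simp
  | add_left x y z hx hy hz h1 h2 => rw [add_mul]; exact Submodule.add_mem _ h1 h2
  | add_right x y z hx hy hz h1 h2 => rw [mul_add]; exact Submodule.add_mem _ h1 h2
  | smul_left r x y hx hy h => rw [smul_mul_assoc]; exact Submodule.smul_mem _ r h
  | smul_right r x y hx hy h => rw [mul_smul_comm]; exact Submodule.smul_mem _ r h

theorem mem_positiveWeight (hb : IsFreeOn k b) {n : ℕ} {z : TensorAlgebra k g}
    (h : IsLeftNormed k g n z) : z ∈ c.positiveWeight := by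
  induction h with
  | of x => exact c.ι_mem_positiveWeight hb x
  | zero n => exact Submodule.zero_mem _
  | add _ _ hx hy => exact Submodule.add_mem _ hx hy
  | smul r _ hx => exact Submodule.smul_mem _ r hx
  | commutator_ι y _ hx =>
    have hy := c.ι_mem_positiveWeight hb y
    exact Submodule.sub_mem _ (c.mul_mem_positiveWeight hx hy)
      (Submodule.smul_mem _ _ (c.mul_mem_positiveWeight hy hx))

open Polynomial in
-- A product of factors `X - (m + 1)` annihilates a sum of eigenvectors, and its constant term is
-- nonzero in characteristic zero. This avoids splitting a cycle into its weight components.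
theorem exists_polynomial_of_mem_positiveWeight [CharZero k] {z : TensorAlgebra k g}
    (hz : z ∈ c.positiveWeight) :
    ∃ P : k[X], P.coeff 0 ≠ 0 ∧
      aeval (R := k) (A := Module.End k (TensorAlgebra k g)) c.weight P z = 0 := by
  rw [positiveWeight] at hz
  induction hz using Submodule.span_induction with
  | mem z hz =>
    obtain ⟨m, hm⟩ := hz
    refine ⟨Polynomial.X - C ((m + 1 : ℕ) : k), ?_, ?_⟩
    · simp only [coeff_sub, coeff_X_zero, coeff_C_zero, zero_sub, neg_ne_zero]
      exact Nat.cast_ne_zero.2 m.succ_ne_zero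
    · rw [map_sub, aeval_X, aeval_C, LinearMap.sub_apply, hm, Module.algebraMap_end_apply, sub_self]
  | zero => exact ⟨1, by simp, by simp⟩
  | add x y _ _ hx hy =>
    obtain ⟨P, hP, hPx⟩ := hx
    obtain ⟨Q, hQ, hQy⟩ := hy
    refine ⟨P * Q, by simp [mul_coeff_zero, hP, hQ], ?_⟩
    rw [map_add]
    nth_rw 1 [mul_comm P Q]
    rw [map_mul, map_mul, Module.End.mul_apply, Module.End.mul_apply, hPx, hQy]
    simp
  | smul r x _ hx =>
    obtain ⟨P, hP, hPx⟩ := hx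
    exact ⟨P, hP, by rw [map_smul, hPx, smul_zero]⟩

theorem weight_mem_freeLieCycles (hb : IsFreeOn k b) {n : ℕ} {z : TensorAlgebra k g}
    (hz : z ∈ freeLieCycles k g (n + 2)) :
    c.weight z ∈ freeLieCycles k g (n + 2) ∧ c.weight z ∈ freeLieBoundaries k g (n + 2) := by
  obtain ⟨hz, hdz⟩ := hz
  have hz := mem_freeLie_iff.1 hz
  have hdz : differential k g z = 0 := hdz
  have hs := mem_freeLie_iff.2 (c.isLeftNormed_homotopy hb hz)
  have hw : c.weight z = differential k g (c.homotopy z) := by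
    rw [← c.homotopy_differential_add hb hz, hdz, map_zero, zero_add]
  rw [hw]
  exact ⟨⟨map_differential_freeLie_le k g (n + 2) ⟨_, hs, rfl⟩, differential_differential _⟩,
    ⟨_, hs, rfl⟩⟩

open Polynomial in
-- Write `P = X Q + P(0)` with `P(W) z = 0`, where `W` is the weight. Then `z` is a multiple of `W
-- (Q(W) z)`; here `Q(W) z` is a cycle because `W` preserves cycles, and `W` sends cycles to
-- boundaries.
theorem _root_.LeibnizAlgebra.IsFreeOn.freeLieCycles_le_freeLieBoundaries [CharZero k]
    (hb : IsFreeOn k b) (n : ℕ) :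
    freeLieCycles k g (n + 2) ≤ freeLieBoundaries k g (n + 2) := by
  intro z hz
  obtain ⟨c⟩ := hb.nonempty_contractionData
  obtain ⟨P, hP, hPz⟩ := c.exists_polynomial_of_mem_positiveWeight
    (c.mem_positiveWeight hb (mem_freeLie_iff.1 hz.1))
  have hinv (Q : k[X]) : aeval (R := k) (A := Module.End k (TensorAlgebra k g)) c.weight Q z ∈
      freeLieCycles k g (n + 2) := by
    induction Q using Polynomial.induction_on' with
    | add p q hp hq =>
      rw [map_add]
      exact Submodule.add_mem _ hp hq
    | monomial m a =>
      rw [aeval_monomial, Module.End.mul_apply, Module.algebraMap_end_apply]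
      refine Submodule.smul_mem _ _ ?_
      induction m with
      | zero => simpa using hz
      | succ m ih =>
        rw [pow_succ', Module.End.mul_apply]
        exact (c.weight_mem_freeLieCycles hb ih).1
  have key : c.weight (aeval (R := k) (A := Module.End k (TensorAlgebra k g)) c.weight P.divX z) +
      P.coeff 0 • z = 0 := by
    rw [← hPz]
    conv_rhs => rw [← X_mul_divX_add P, map_add, map_mul, aeval_X, aeval_C]
    rfl
  have hz' : z = -(P.coeff 0)⁻¹ •
      c.weight (aeval (R := k) (A := Module.End k (TensorAlgebra k g)) c.weight P.divX z) := by
    rw [eq_neg_of_add_eq_zero_left key, neg_smul, smul_neg, neg_neg, smul_smul, inv_mul_cancel₀ hP,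
      one_smul]
  rw [hz']
  exact Submodule.smul_mem _ _ (c.weight_mem_freeLieCycles hb (hinv _)).2

end ContractionData

end

end LeibnizAlgebra

/-- For every Leibniz algebra `g` over a field of characteristic zero, `(T(g), d)` is a complex
and `F(g)` is a subcomplex of it. If `g` is free, `Hₙ(F(g)) = 0` for all `n > 1`. -/
theorem mainTheorem1 {k : Type u} {g : Type v} [Field k] [CharZero k] [AddCommGroup g] [Module k g]
    [LeibnizAlgebra k g] :
    LeibnizAlgebra.differential k g ∘ₗ LeibnizAlgebra.differential k g = 0 ∧
    (∀ n : ℕ, (LeibnizAlgebra.freeLie k g (n + 1)).map (LeibnizAlgebra.differential k g) ≤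
      LeibnizAlgebra.freeLie k g n) ∧
    (∀ {X : Type w} (b : X → g), LeibnizAlgebra.IsFreeOn k b →
      ∀ n : ℕ, 1 < n → Subsingleton (LeibnizAlgebra.freeLieHomology k g n)) := by

  refine ⟨LinearMap.ext LeibnizAlgebra.differential_differential,
    LeibnizAlgebra.map_differential_freeLie_le k g, ?_⟩
  intro X b hb n hn
  obtain ⟨m, rfl⟩ : ∃ m, n = m + 2 := ⟨n - 2, by omega⟩
  rw [Submodule.Quotient.subsingleton_iff, Submodule.submoduleOf,
    Submodule.comap_subtype_eq_top]
  exact hb.freeLieCycles_le_freeLieBoundaries m
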